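/- Let $K$ be a field and let $A$ be a finite-dimensional $K$-multialgebra, i.e. a finite-dimensional $K$-vector space equipped with a family of $K$-multilinear operations $\mu_i\colon A^{n_i}\to A$ ($i\in I$, $n_i\ge 0$). For example, $A$ may be a $K$-algebra, with its product, possibly with a unit (an operation with no arguments) and an involution. A subalgebra of $A$ is a subspace closed under all the operations. For every field extension $L/K$, let $A_L=A\otimes_K L$ be the induced $L$-multialgebra; elements $a_1,\dots,a_r$ generate $A_L$ if no proper subalgebra of $A_L$ contains them all. For $r\in\mathbb{N}$, let $V_r$ be the affine space over $K$ underlying $A^r$, and let $Z_r\subseteq V_r$ be the closed subscheme of non-generating $r$-tuples, so that \[Z_r(L)=\{(a_1,\dots,a_r)\in A_L^r : a_1,\dots,a_r \text{ do not generate } A_L\}\] for every field extension $L/K$. Suppose that $A$ has at least one proper subalgebra. Let $\overline{K}$ be an algebraic closure of $K$, and let $G$ be the identity connected component of the algebraic group $\mathrm{Aut}_{\overline{K}}(A_{\overline{K}})$ of automorphisms of the multialgebra $A_{\overline{K}}$. Suppose that the action of $G(\overline{K})$ on the set of maximal (proper) subalgebras of $A_{\overline{K}}$ has finitely many orbits.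 Then there exist integers $a,b\ge 0$ such that $\dim Z_r=ar+b$ for every sufficiently large $r$. -/

import Mathlib

open TensorProduct

/-- The operations of a `K`-multialgebra with underlying space `A`: a family, indexed by `I`, of
`K`-multilinear maps `A ^ (n i) → A`. Arity two gives a product, arity one an involution, arity
zero a distinguished element such as a unit. -/
abbrev MultiOps (K A : Type*) [CommRing K] [AddCommGroup A] [Module K A] {I : Type*} (n : I → ℕ) :=
  ∀ i : I, MultilinearMap K (fun _ : Fin (n i) => A) A

namespace MultiOps

section General

variable {K A I : Type*} [CommRing K] [AddCommGroup A] [Module K A] {n : I → ℕ}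

/-- A subalgebra: a subspace closed under all the operations. -/
def IsSubalgebra (μ : MultiOps K A n) (S : Submodule K A) : Prop :=
  ∀ (i : I) (x : Fin (n i) → A), (∀ j, x j ∈ S) → μ i x ∈ S

/-- The subalgebra generated by a subset: the smallest subspace that contains it and is closed
under all the operations. -/
def adjoin (μ : MultiOps K A n) (s : Set A) : Submodule K A :=
  sInf {S | μ.IsSubalgebra S ∧ s ⊆ S}

/-- A subset generates the multialgebra. -/
def Generates (μ : MultiOps K A n) (s : Set A) : Prop :=
  μ.adjoin s = ⊤

/-- A maximal subalgebra: a maximal member of the family of proper subalgebras. -/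
def IsMaximalSubalgebra (μ : MultiOps K A n) (S : Submodule K A) : Prop :=
  Maximal (fun T => μ.IsSubalgebra T ∧ T ≠ ⊤) S

/-- The group of automorphisms of the multialgebra. -/
def autGroup (μ : MultiOps K A n) : Subgroup (A ≃ₗ[K] A) where
  carrier := {g | ∀ (i : I) (x : Fin (n i) → A), g (μ i x) = μ i (fun j => g (x j))}
  one_mem' := fun _ _ => rfl
  mul_mem' := by
    intro g h hg hh i x
    simp only [Set.mem_ofPred_eq] at hg hh
    simp only [LinearEquiv.mul_apply, hh, hg]
  inv_mem' := by
    intro g hg i x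
    simp only [Set.mem_ofPred_eq] at hg
    apply g.injective
    rw [hg]
    simp

end General

end MultiOps

section Zariski

/-- The polynomial functions on a vector space: the algebra of functions generated by the linear
functionals. -/
def zariskiPolyFun (K V : Type*) [Field K] [AddCommGroup V] [Module K V] :
    Subalgebra K (V → K) :=
  Algebra.adjoin K (Set.range fun (φ : Module.Dual K V) (v : V) => φ v)

/-- The Zariski topology on (the set of `K`-points of) a vector space `V`. Its basic open sets are
the sets where some polynomial function does not vanish. -/
@[reducible]
def zariskiTopology (K V : Type*) [Field K] [AddCommGroup V] [Module K V] : TopologicalSpace V :=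
  TopologicalSpace.generateFrom {U | ∃ f ∈ zariskiPolyFun K V, U = {v | f v ≠ 0}}

theorem zariskiPolyFun_comp {K V W : Type*} [Field K] [AddCommGroup V] [Module K V]
    [AddCommGroup W] [Module K W] (l : V →ₗ[K] W) {f : W → K} (hf : f ∈ zariskiPolyFun K W) :
    (fun v => f (l v)) ∈ zariskiPolyFun K V := by
  unfold zariskiPolyFun at hf
  induction hf using Algebra.adjoin_induction with
  | mem f hf =>
    obtain ⟨φ, rfl⟩ := hf
    exact Algebra.subset_adjoin ⟨φ.comp l, rfl⟩
  | algebraMap c => exact (zariskiPolyFun K V).algebraMap_mem c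
  | add f g _ _ hf hg => exact (zariskiPolyFun K V).add_mem hf hg
  | mul f g _ _ hf hg => exact (zariskiPolyFun K V).mul_mem hf hg

theorem zariski_continuous_linear {K V W : Type*} [Field K] [AddCommGroup V] [Module K V]
    [AddCommGroup W] [Module K W] (l : V →ₗ[K] W) :
    @Continuous V W (zariskiTopology K V) (zariskiTopology K W) l := by
  let := zariskiTopology K V
  refine (continuous_generateFrom_iff (b := {U | ∃ f ∈ zariskiPolyFun K W, U = {v | f v ≠ 0}})).2 ?_
  rintro _ ⟨f, hf, rfl⟩
  exact TopologicalSpace.isOpen_generateFrom_of_mem ⟨_, zariskiPolyFun_comp l hf, rfl⟩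

end Zariski

namespace MultiOps

section Field

variable {K A I : Type*} [Field K] [AddCommGroup A] [Module K A] {n : I → ℕ}

/-- The Zariski topology on the group of automorphisms, as a subset of the vector space
`End_K(A)`. -/
@[reducible]
def autTopology (μ : MultiOps K A n) : TopologicalSpace μ.autGroup :=
  TopologicalSpace.induced (fun g => ((g : A ≃ₗ[K] A) : A →ₗ[K] A)) (zariskiTopology K (A →ₗ[K] A))

theorem autTopology_continuous_mul_left (μ : MultiOps K A n) (g : μ.autGroup) :
    @Continuous _ _ μ.autTopology μ.autTopology (fun h => g * h) := by
  let := zariskiTopology K (A →ₗ[K] A)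
  let := μ.autTopology
  refine continuous_induced_rng.2 ?_
  exact (zariski_continuous_linear
    (LinearMap.lcomp K A (LinearMap.id : A →ₗ[K] A) ∘ₗ
      LinearMap.llcomp K A A A ((g : A ≃ₗ[K] A) : A →ₗ[K] A))).comp continuous_induced_dom

/-- The identity component of the automorphism group: the connected component of the identity
in the Zariski topology. It is used over algebraically closed fields, where it is the group of
rational points of the identity component of the algebraic group of automorphisms. -/
def identityComponent (μ : MultiOps K A n) : Subgroup μ.autGroup where
  carrier := @connectedComponent _ μ.autTopology 1
  one_mem' := @mem_connectedComponent _ μ.autTopology 1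
  mul_mem' := by
    let := μ.autTopology
    intro g h hg hh
    have h1 : IsPreconnected ((fun x => g * x) '' connectedComponent (1 : μ.autGroup)) :=
      isPreconnected_connectedComponent.image _ (μ.autTopology_continuous_mul_left g).continuousOn
    have h2 := h1.subset_connectedComponent (x := g) ⟨1, mem_connectedComponent, mul_one g⟩
    rw [← connectedComponent_eq hg] at h2
    exact h2 ⟨h, hh, rfl⟩
  inv_mem' := by
    let := μ.autTopology
    intro g hg
    have h1 : IsPreconnected ((fun x => g⁻¹ * x) '' connectedComponent (1 : μ.autGroup)) :=
      isPreconnected_connectedComponent.image _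
        (μ.autTopology_continuous_mul_left g⁻¹).continuousOn
    have h2 := h1.subset_connectedComponent (x := 1) ⟨g, hg, inv_mul_cancel g⟩
    exact h2 ⟨1, mem_connectedComponent, mul_one _⟩

/-- The action of the identity component of the automorphism group on the set of maximal
subalgebras has finitely many orbits: there is a finite set of maximal subalgebras such that
every maximal subalgebra is the image of a member of the set. -/
def FinitelyManyOrbits (μ : MultiOps K A n) : Prop :=
  ∃ T : Set (Submodule K A), T.Finite ∧ (∀ S ∈ T, μ.IsMaximalSubalgebra S) ∧
    ∀ B, μ.IsMaximalSubalgebra B → ∃ S ∈ T, ∃ g ∈ μ.identityComponent,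
      S.map ((g : A ≃ₗ[K] A) : A →ₗ[K] A) = B

variable [FiniteDimensional K A]

/-- Extension of scalars of a multialgebra, from `A` to `L ⊗ A`. By `baseChange_tmul` it is the
`L`-multilinear extension of the operations of `A`. -/
noncomputable def baseChange (L : Type*) [CommRing L] [Algebra K L] (μ : MultiOps K A n) :
    MultiOps L (L ⊗[K] A) n := fun i =>
  ∑ f : Fin (n i) → Fin (Module.finrank K A),
    (MultilinearMap.mkPiRing L (Fin (n i))
      ((1 : L) ⊗ₜ[K] μ i (fun j => Module.finBasis K A (f j)))).compLinearMap
        (fun j => ((Module.finBasis K A).baseChange L).coord (f j))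

theorem baseChange_tmul (L : Type*) [CommRing L] [Algebra K L] (μ : MultiOps K A n) (i : I)
    (l : Fin (n i) → L) (a : Fin (n i) → A) :
    μ.baseChange L i (fun j => l j ⊗ₜ[K] a j) = (∏ j, l j) ⊗ₜ[K] μ i a := by
  have h : μ i a = ∑ f : Fin (n i) → Fin (Module.finrank K A),
      (∏ j, (Module.finBasis K A).repr (a j) (f j)) •
        μ i (fun j => Module.finBasis K A (f j)) := by
    conv_lhs => rw [show a = fun j => ∑ k, (Module.finBasis K A).repr (a j) k •
      Module.finBasis K A k from funext fun j => ((Module.finBasis K A).sum_repr (a j)).symm]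
    rw [MultilinearMap.map_sum]
    simp only [MultilinearMap.map_smul_univ]
  rw [h, TensorProduct.tmul_sum]
  simp only [baseChange, sum_apply, MultilinearMap.compLinearMap_apply,
    MultilinearMap.mkPiRing_apply, Module.Basis.coord_apply, Module.Basis.baseChange_repr_tmul]
  refine Finset.sum_congr rfl fun f _ => ?_
  rw [TensorProduct.smul_tmul', smul_eq_mul, mul_one, TensorProduct.tmul_smul,
    TensorProduct.smul_tmul', ← Finset.prod_smul]

/-- The affine space `V_r` underlying `A ^ r`, as the prime spectrum of a polynomial ring: the
variable `(j, k)` is the `k`-th coordinate of the `j`-th entry in a fixed basis of `A`. -/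
abbrev AffineTuples (K A : Type*) [Field K] [AddCommGroup A] [Module K A] (r : ℕ) :=
  PrimeSpectrum (MvPolynomial (Fin r × Fin (Module.finrank K A)) K)

/-- The `r`-tuple in `κ(p) ⊗ A` which corresponds to a point `p` of the scheme `V_r`, where
`κ(p)` is the residue field of `p`. -/
noncomputable def tupleAt {r : ℕ} (p : AffineTuples K A r) (j : Fin r) :
    p.asIdeal.ResidueField ⊗[K] A :=
  ∑ k, algebraMap (MvPolynomial (Fin r × Fin (Module.finrank K A)) K) p.asIdeal.ResidueField
    (MvPolynomial.X (j, k)) ⊗ₜ[K] Module.finBasis K A k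

/-- The underlying space of the closed subscheme `Z_r` of `V_r` of non-generating `r`-tuples: it
consists of the points `p` of `V_r` whose `r`-tuple does not generate the multialgebra
`κ(p) ⊗ A` over `κ(p)`. -/
def nonGenerating (μ : MultiOps K A n) (r : ℕ) : Set (AffineTuples K A r) :=
  {p | ¬ (μ.baseChange p.asIdeal.ResidueField).Generates (Set.range (tupleAt p))}

end Field

end MultiOps

/-! Let `a` be the largest dimension of a proper subalgebra of `L ⊗ A`, over extensions `L` of `K`.
If `B` is such a subalgebra of dimension `a`, then tuples in `B` do not generate, and a generic
`r`-tuple of `B` has `r * a` algebraically independent coordinates; so `dim Z_r ≥ a r`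
(`HasProperSubalgebraOfDim.exists_le_pointDim`). Conversely, take a point of `Z_{r+1}` whose closure
has maximal dimension. Its entries lie in a proper subalgebra over the residue field, so their span
has dimension at most `a`. If `r ≥ a`, some entry is a combination of at most `a` others. Dropping
it leaves a point of `Z_r`, and the coefficients of the combination recover the residue field, so
that `dim Z_{r+1} ≤ dim Z_r + a` (`exists_pointDim_le_add`). Hence `dim Z_r - a r` is nonincreasing
for `r ≥ a` and nonnegative, and is eventually constant (`exists_eventually_eq_mul_add`). The
passage between topological dimension and transcendence degrees of points uses that `Z_r` is closed
(`nonGenerating_eq_zeroLocus`). -/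

open Order

/-! ### Krull dimension and transcendence degree. -/

section DimensionTheory

theorem ringKrullDim_eq_of_isIntegral (R S : Type*) [CommRing R] [CommRing S] [Algebra R S]
    [Algebra.IsIntegral R S] [FaithfulSMul R S] : ringKrullDim S = ringKrullDim R := by
  have hmono : StrictMono (PrimeSpectrum.comap (algebraMap R S)) := fun p q h =>
    Ideal.IsIntegral.comap_lt_comap h
  refine le_antisymm (krullDim_le_of_strictMono _ hmono) ?_
  refine iSup_le fun l => ?_
  obtain ⟨P, hP⟩ := Algebra.IsIntegral.comap_surjective R S l.head
  have : P.asIdeal.LiesOver l.head.asIdeal := ⟨congrArg PrimeSpectrum.asIdeal hP.symm⟩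
  obtain ⟨L, hL, -⟩ := Ideal.exists_ltSeries_of_hasGoingUp (S := S) l P.asIdeal
  rw [← hL]
  exact L.length_le_krullDim

/-- Noether normalization: `B` is integral over a polynomial ring in `n` variables, for which both
invariants are `n`. -/
theorem exists_ringKrullDim_eq_trdeg_eq (K B : Type*) [Field K] [CommRing B] [IsDomain B]
    [Algebra K B] [Algebra.FiniteType K B] :
    ∃ n : ℕ, ringKrullDim B = n ∧ Algebra.trdeg K B = n := by
  obtain ⟨n, g, hinj, hint⟩ := exists_integral_inj_algHom_of_fg K B
  let := g.toRingHom.toAlgebra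
  have : IsScalarTower K (MvPolynomial (Fin n) K) B :=
    IsScalarTower.of_algebraMap_eq fun x => (g.commutes x).symm
  have : Algebra.IsIntegral (MvPolynomial (Fin n) K) B := ⟨hint⟩
  have : FaithfulSMul (MvPolynomial (Fin n) K) B :=
    (faithfulSMul_iff_algebraMap_injective _ _).2 hinj
  refine ⟨n, ?_, ?_⟩
  · rw [ringKrullDim_eq_of_isIntegral (MvPolynomial (Fin n) K) B,
      MvPolynomial.ringKrullDim_of_isNoetherianRing]
    simp
  · have := lift_trdeg_add_eq K (MvPolynomial (Fin n) K) B
    rw [trdeg_eq_zero (R := MvPolynomial (Fin n) K), _root_.MvPolynomial.trdeg_of_isDomain] at this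
    simpa using this.symm

/-- Irreducible closed subsets correspond to primes with the order reversed, and a chain of primes
lies in the closure of its smallest member. -/
theorem topologicalKrullDim_zeroLocus {R : Type*} [CommRing R] (s : Set R) :
    topologicalKrullDim (PrimeSpectrum.zeroLocus s) =
      ⨆ p ∈ PrimeSpectrum.zeroLocus s, ringKrullDim (R ⧸ p.asIdeal) := by
  have h : topologicalKrullDim (PrimeSpectrum.zeroLocus s) =
      krullDim (PrimeSpectrum.zeroLocus s) := by
    rw [krullDim_eq_of_orderIso (PrimeSpectrum.zeroLocusEquivIrreducibleCloseds s),
      krullDim_orderDual]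
    rfl
  rw [h]
  refine le_antisymm (iSup_le fun l => ?_) (iSup₂_le fun p hp => ?_)
  · refine le_trans ?_ (le_iSup₂ l.head.1 l.head.2)
    rw [ringKrullDim_quotient]
    let e : {q : PrimeSpectrum.zeroLocus s // l.head ≤ q} →
        PrimeSpectrum.zeroLocus (l.head.1.asIdeal : Set R) := fun q => ⟨q.1.1, q.2⟩
    let l' : LTSeries (PrimeSpectrum.zeroLocus (l.head.1.asIdeal : Set R)) :=
      ⟨l.length, fun i => ⟨(l i).1, l.head_le i⟩, fun i => l.step i⟩
    exact l'.length_le_krullDim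
  · rw [ringKrullDim_quotient]
    exact krullDim_le_of_strictMono
      (fun q : PrimeSpectrum.zeroLocus (p.asIdeal : Set R) =>
        (⟨q.1, Set.Subset.trans hp q.2⟩ : PrimeSpectrum.zeroLocus s)) fun _ _ h => h

end DimensionTheory

namespace MultiOps

/-! ### Generated subalgebras. -/

section Adjoin

variable {K A I : Type*} [CommRing K] [AddCommGroup A] [Module K A] {n : I → ℕ}

theorem isSubalgebra_adjoin (μ : MultiOps K A n) (s : Set A) : μ.IsSubalgebra (μ.adjoin s) := by
  intro i x hx
  refine Submodule.mem_sInf.2 fun S hS => hS.1 i x fun j => ?_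
  exact Submodule.mem_sInf.1 (hx j) S hS

theorem subset_adjoin (μ : MultiOps K A n) (s : Set A) : s ⊆ μ.adjoin s := fun _ ha =>
  Submodule.mem_sInf.2 fun _ hS => hS.2 ha

theorem adjoin_le (μ : MultiOps K A n) {s : Set A} {S : Submodule K A} (hS : μ.IsSubalgebra S)
    (h : s ⊆ S) : μ.adjoin s ≤ S :=
  sInf_le ⟨hS, h⟩

theorem Generates.mono {μ : MultiOps K A n} {s t : Set A} (h : s ⊆ t) (hs : μ.Generates s) :
    μ.Generates t :=
  top_le_iff.1 (hs.symm.trans_le (μ.adjoin_le (μ.isSubalgebra_adjoin t)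
    (h.trans (μ.subset_adjoin t))))

theorem isSubalgebra_span (μ : MultiOps K A n) {s : Set A}
    (h : ∀ (i : I) (x : Fin (n i) → A), (∀ j, x j ∈ s) → μ i x ∈ Submodule.span K s) :
    μ.IsSubalgebra (Submodule.span K s) := by
  intro i x hx
  have h1 : ∀ j, ∃ (c : A →₀ K), (↑c.support ⊆ s) ∧ c.sum (fun m a => a • m) = x j := fun j => by
    obtain ⟨c, hc, hx⟩ := Submodule.mem_span_set.1 (hx j)
    exact ⟨c, hc, hx⟩
  choose c hc hcx using h1
  rw [show x = fun j => ∑ m ∈ (c j).support, c j m • m from funext fun j => (hcx j).symm,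
    MultilinearMap.map_sum_finset]
  refine Submodule.sum_mem _ fun f hf => ?_
  rw [MultilinearMap.map_smul_univ]
  exact Submodule.smul_mem _ _ (h i _ fun j => hc j (Fintype.mem_piFinset.1 hf j))

end Adjoin

/-! ### Generation under change of scalars. -/

section BaseChange

variable {K A I R S : Type*} [Field K] [AddCommGroup A] [Module K A] {n : I → ℕ}
  [CommRing R] [Algebra K R] [CommRing S] [Algebra K S]

/-- The map `R ⊗ A → S ⊗ A` induced by a homomorphism `R → S` of `K`-algebras. -/
noncomputable def scalarMap (A : Type*) [AddCommGroup A] [Module K A] (f : R →ₐ[K] S) :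
    R ⊗[K] A →ₗ[K] S ⊗[K] A :=
  f.toLinearMap.rTensor A

@[simp]
theorem scalarMap_tmul (f : R →ₐ[K] S) (r : R) (a : A) :
    scalarMap A f (r ⊗ₜ[K] a) = f r ⊗ₜ[K] a := rfl

theorem scalarMap_smul (f : R →ₐ[K] S) (r : R) (x : R ⊗[K] A) :
    scalarMap A f (r • x) = f r • scalarMap A f x := by
  induction x with
  | zero => simp
  | tmul s a => simp [TensorProduct.smul_tmul']
  | add x y hx hy => simp [hx, hy]

variable [FiniteDimensional K A]

variable (K A R) in
/-- The basis of `R ⊗ A` over `R` obtained from the fixed basis of `A`. -/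
noncomputable abbrev scalarBasis : Module.Basis (Fin (Module.finrank K A)) R (R ⊗[K] A) :=
  (Module.finBasis K A).baseChange R

theorem scalarBasis_repr_scalarMap (f : R →ₐ[K] S) (x : R ⊗[K] A) (k : Fin (Module.finrank K A)) :
    (scalarBasis K A S).repr (scalarMap A f x) k = f ((scalarBasis K A R).repr x k) := by
  induction x with
  | zero => simp
  | tmul s a => simp [Module.Basis.baseChange_repr_tmul]
  | add x y hx hy => simp [hx, hy]

theorem baseChange_apply (μ : MultiOps K A n) (i : I) (x : Fin (n i) → R ⊗[K] A) :
    μ.baseChange R i x = ∑ f : Fin (n i) → Fin (Module.finrank K A),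
      (∏ j, (scalarBasis K A R).repr (x j) (f j)) •
        ((1 : R) ⊗ₜ[K] μ i (fun j => Module.finBasis K A (f j))) := by
  simp only [baseChange, sum_apply, MultilinearMap.compLinearMap_apply,
    MultilinearMap.mkPiRing_apply, Module.Basis.coord_apply]

theorem scalarMap_baseChange (μ : MultiOps K A n) (f : R →ₐ[K] S) (i : I)
    (x : Fin (n i) → R ⊗[K] A) :
    scalarMap A f (μ.baseChange R i x) = μ.baseChange S i (fun j => scalarMap A f (x j)) := by
  simp only [baseChange_apply, map_sum, scalarMap_smul, map_prod, scalarBasis_repr_scalarMap,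
    scalarMap_tmul, map_one]

/-- The preimage under `R ⊗ A → S ⊗ A` of an `S`-subspace. -/
noncomputable def comapScalarMap (f : R →ₐ[K] S) (T : Submodule S (S ⊗[K] A)) :
    Submodule R (R ⊗[K] A) where
  carrier := {x | scalarMap A f x ∈ T}
  zero_mem' := by simp
  add_mem' hx hy := by simpa using T.add_mem hx hy
  smul_mem' r x hx := by simpa [scalarMap_smul] using T.smul_mem (f r) hx

theorem IsSubalgebra.comapScalarMap {μ : MultiOps K A n} (f : R →ₐ[K] S)
    {T : Submodule S (S ⊗[K] A)} (hT : (μ.baseChange S).IsSubalgebra T) :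
    (μ.baseChange R).IsSubalgebra (comapScalarMap f T) := fun i x hx => by
  change scalarMap A f _ ∈ T
  rw [scalarMap_baseChange]
  exact hT i _ hx

theorem IsSubalgebra.span_scalarMap {μ : MultiOps K A n} (f : R →ₐ[K] S)
    {M : Submodule R (R ⊗[K] A)} (hM : (μ.baseChange R).IsSubalgebra M) :
    (μ.baseChange S).IsSubalgebra (Submodule.span S (scalarMap A f '' M)) := by
  refine isSubalgebra_span _ fun i x hx => ?_
  choose y hy hyx using hx
  rw [← funext hyx, ← scalarMap_baseChange]
  exact Submodule.subset_span ⟨_, hM i y hy, rfl⟩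

/-- Subalgebras pull back to subalgebras along `scalarMap`, and the span of the image of a
subalgebra is a subalgebra. -/
theorem adjoin_image_scalarMap (μ : MultiOps K A n) (f : R →ₐ[K] S) (s : Set (R ⊗[K] A)) :
    (μ.baseChange S).adjoin (scalarMap A f '' s) =
      Submodule.span S (scalarMap A f '' (μ.baseChange R).adjoin s) := by
  refine le_antisymm (adjoin_le _
    (IsSubalgebra.span_scalarMap f ((μ.baseChange R).isSubalgebra_adjoin s)) ?_)
    (Submodule.span_le.2 ?_)
  · exact (Set.image_mono ((μ.baseChange R).subset_adjoin s)).trans Submodule.subset_span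
  · rintro _ ⟨x, hx, rfl⟩
    exact adjoin_le _ (IsSubalgebra.comapScalarMap f ((μ.baseChange S).isSubalgebra_adjoin _))
      
      (fun y hy => (μ.baseChange S).subset_adjoin (scalarMap A f '' s)
        (Set.mem_image_of_mem _ hy)) hx

/-- The determinants on the right are formed over `R`, independently of `L`; this makes
non-generation a closed condition. A spanning set over a field contains a basis, and a basis is
detected by its determinant. -/
theorem generates_image_scalarMap_iff {L : Type*} [Field L] [Algebra K L] (μ : MultiOps K A n)
    (f : R →ₐ[K] L) (s : Set (R ⊗[K] A)) :
    (μ.baseChange L).Generates (scalarMap A f '' s) ↔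
      ∃ m : Fin (Module.finrank K A) → R ⊗[K] A,
        (∀ i, m i ∈ (μ.baseChange R).adjoin s) ∧ f ((scalarBasis K A R).det m) ≠ 0 := by
  have hdet : ∀ m : Fin (Module.finrank K A) → R ⊗[K] A, f ((scalarBasis K A R).det m) =
      (scalarBasis K A L).det fun i => scalarMap A f (m i) := fun m => by
    rw [Module.Basis.det_apply, Module.Basis.det_apply, AlgHom.map_det]
    congr 1
    ext i j
    simp [Module.Basis.toMatrix_apply, scalarBasis_repr_scalarMap]
  rw [Generates, adjoin_image_scalarMap]
  constructor
  · intro h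
    obtain ⟨b, hb, hspan, hli⟩ := exists_linearIndependent L
      (scalarMap A f '' (μ.baseChange R).adjoin s)
    rw [h] at hspan
    have B := Module.Basis.mk hli (by rw [Subtype.range_coe, hspan])
    let e := B.indexEquiv (scalarBasis K A L)
    have hmem := fun i => hb (e.symm i).2
    choose m hm hmb using hmem
    refine ⟨m, hm, ?_⟩
    rw [hdet]
    refine IsUnit.ne_zero (((scalarBasis K A L).is_basis_iff_det).1 ⟨?_, ?_⟩)
    · simp only [hmb]
      exact hli.comp _ e.symm.injective
    · rw [funext hmb, ← hspan]
      congr 1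
      ext x
      exact ⟨by rintro ⟨i, rfl⟩; exact (e.symm i).2, fun hx => ⟨e ⟨x, hx⟩, by simp⟩⟩
  · rintro ⟨m, hm, hne⟩
    rw [hdet] at hne
    refine top_le_iff.1 ?_
    rw [← (((scalarBasis K A L).is_basis_iff_det).2 (isUnit_iff_ne_zero.2 hne)).2]
    refine Submodule.span_mono ?_
    rintro _ ⟨i, rfl⟩
    exact ⟨m i, hm i, rfl⟩

end BaseChange

/-! ### The universal tuple and the equations of `Z_r`. -/

section Tuples

variable {K A I : Type*} [Field K] [AddCommGroup A] [Module K A] [FiniteDimensional K A]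
  {n : I → ℕ}

/-- The coordinate ring of the affine space of `r`-tuples. -/
abbrev TupleRing (K A : Type*) [Field K] [AddCommGroup A] [Module K A] (r : ℕ) :=
  MvPolynomial (Fin r × Fin (Module.finrank K A)) K

variable (K A) in
/-- The universal `r`-tuple, with entries in the extension of `A` to the coordinate ring of the
affine space of `r`-tuples. -/
noncomputable def genericTuple (r : ℕ) (j : Fin r) : TupleRing K A r ⊗[K] A :=
  ∑ k, MvPolynomial.X (j, k) ⊗ₜ[K] Module.finBasis K A k

/-- The `r`-tuple which corresponds to a homomorphism from the coordinate ring. -/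
noncomputable def tupleOf {L : Type*} [CommRing L] [Algebra K L] {r : ℕ}
    (g : TupleRing K A r →ₐ[K] L) (j : Fin r) : L ⊗[K] A :=
  scalarMap A g (genericTuple K A r j)

theorem tupleOf_eq_sum {L : Type*} [CommRing L] [Algebra K L] {r : ℕ}
    (g : TupleRing K A r →ₐ[K] L) (j : Fin r) :
    tupleOf g j = ∑ k, g (MvPolynomial.X (j, k)) ⊗ₜ[K] Module.finBasis K A k := by
  simp [tupleOf, genericTuple]

theorem tupleOf_eq_iff {L : Type*} [CommRing L] [Algebra K L] {r : ℕ}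
    (g : TupleRing K A r →ₐ[K] L) (j : Fin r) (x : L ⊗[K] A) :
    tupleOf g j = x ↔
      ∀ k, g (MvPolynomial.X (j, k)) = (scalarBasis K A L).repr x k := by
  have h : tupleOf g j = ∑ k, g (MvPolynomial.X (j, k)) • scalarBasis K A L k := by
    simp [tupleOf_eq_sum, TensorProduct.smul_tmul']
  rw [← (scalarBasis K A L).repr.injective.eq_iff, Finsupp.ext_iff, h]
  simp only [Module.Basis.repr_sum_self]

theorem tupleAt_eq_tupleOf {r : ℕ} (p : AffineTuples K A r) :
    tupleAt p = tupleOf (IsScalarTower.toAlgHom K (TupleRing K A r) p.asIdeal.ResidueField) := by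
  ext j
  rw [tupleOf_eq_sum]
  rfl

theorem generates_tupleOf_iff {L : Type*} [Field L] [Algebra K L] (μ : MultiOps K A n) {r : ℕ}
    (g : TupleRing K A r →ₐ[K] L) : (μ.baseChange L).Generates (Set.range (tupleOf g)) ↔
      ∃ m : Fin (Module.finrank K A) → TupleRing K A r ⊗[K] A,
        (∀ i, m i ∈ (μ.baseChange _).adjoin (Set.range (genericTuple K A r))) ∧
          g ((scalarBasis K A _).det m) ≠ 0 := by
  rw [← generates_image_scalarMap_iff, ← Set.range_comp]
  rfl

/-- The determinants which cut out the set of non-generating tuples. -/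
def generatingDets (μ : MultiOps K A n) (r : ℕ) : Set (TupleRing K A r) :=
  {q | ∃ m : Fin (Module.finrank K A) → TupleRing K A r ⊗[K] A,
    (∀ i, m i ∈ (μ.baseChange _).adjoin (Set.range (genericTuple K A r))) ∧
      (scalarBasis K A _).det m = q}

theorem not_generates_tupleOf_iff {L : Type*} [Field L] [Algebra K L] (μ : MultiOps K A n) {r : ℕ}
    (g : TupleRing K A r →ₐ[K] L) : ¬ (μ.baseChange L).Generates (Set.range (tupleOf g)) ↔
      μ.generatingDets r ⊆ RingHom.ker g := by
  rw [generates_tupleOf_iff]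
  constructor
  · rintro h _ ⟨m, hm, rfl⟩
    by_contra hne
    exact h ⟨m, hm, hne⟩
  · rintro h ⟨m, hm, hne⟩
    exact hne (h ⟨m, hm, rfl⟩)

theorem nonGenerating_eq_zeroLocus (μ : MultiOps K A n) (r : ℕ) :
    μ.nonGenerating r = PrimeSpectrum.zeroLocus (μ.generatingDets r) := by
  ext p
  have h : (RingHom.ker (IsScalarTower.toAlgHom K (TupleRing K A r) p.asIdeal.ResidueField) :
      Ideal (TupleRing K A r)) = p.asIdeal :=
    Ideal.ker_algebraMap_residueField p.asIdeal
  rw [nonGenerating, Set.mem_ofPred_eq, tupleAt_eq_tupleOf, not_generates_tupleOf_iff, h]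
  rfl

/-- The point of the affine space of tuples below a tuple with entries in an extension of `A` to a
field. -/
noncomputable def kernelPoint {L : Type*} [Field L] [Algebra K L] {r : ℕ} (g : TupleRing K A r →ₐ[K] L) :
    AffineTuples K A r :=
  ⟨RingHom.ker g, RingHom.ker_isPrime g⟩

theorem kernelPoint_mem_nonGenerating_iff {L : Type*} [Field L] [Algebra K L] (μ : MultiOps K A n)
    {r : ℕ} (g : TupleRing K A r →ₐ[K] L) : kernelPoint g ∈ μ.nonGenerating r ↔
      ¬ (μ.baseChange L).Generates (Set.range (tupleOf g)) := by
  rw [nonGenerating_eq_zeroLocus, not_generates_tupleOf_iff]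
  rfl

end Tuples

end MultiOps

/-! ### The upper bound: dropping a redundant entry. -/

theorem trdeg_le_trdeg_add_card {K L ι : Type*} [Field K] [Field L] [Algebra K L] [Fintype ι]
    (E : Subalgebra K L) (c : ι → L) [Algebra.IsAlgebraic (Algebra.adjoin E (Set.range c)) L] :
    Algebra.trdeg K L ≤ Algebra.trdeg K E + Fintype.card ι := by
  rw [← trdeg_add_eq K E (A := L)]
  gcongr
  refine (Algebra.IsAlgebraic.trdeg_le_cardinalMk E (Set.range c)).trans ?_
  rw [← Cardinal.lift_le_nat_iff]
  exact Cardinal.mk_range_le_lift.trans (by simp)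

/-- Among more vectors than the dimension of their span, one is a combination of the others, with a
family of coefficients whose size is the dimension of the span. -/
theorem exists_eq_sum_smul_ne {L V ι : Type*} [Field L] [AddCommGroup V] [Module L V] [Finite ι]
    (x : ι → V) (h : Module.finrank L (Submodule.span L (Set.range x)) < Nat.card ι) :
    ∃ (i₀ : ι) (s : Finset ι) (c : ι → L), i₀ ∉ s ∧
      s.card = Module.finrank L (Submodule.span L (Set.range x)) ∧ x i₀ = ∑ i ∈ s, c i • x i := by
  classical
  have := Fintype.ofFinite ι
  obtain ⟨κ, a, ha, hspan, hli⟩ := exists_linearIndependent' L x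
  have := Fintype.ofInjective a ha
  have hcard := finrank_span_eq_card hli
  rw [hspan] at hcard
  have hs : (Finset.univ.image a).card = Fintype.card κ := Finset.card_image_of_injective _ ha
  obtain ⟨i₀, hi₀⟩ : ∃ i₀, i₀ ∉ Finset.univ.image a := by
    by_contra! hall
    have := Finset.card_le_card (fun i _ => hall i : (Finset.univ : Finset ι) ⊆ _)
    rw [Finset.card_univ, hs, ← Nat.card_eq_fintype_card] at this
    omega
  have hmem : x i₀ ∈ Submodule.span L (Set.range (x ∘ a)) := by
    rw [hspan]
    exact Submodule.subset_span ⟨i₀, rfl⟩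
  rw [Set.range_comp, show Set.range a = ↑(Finset.univ.image a) by simp] at hmem
  obtain ⟨c, hc⟩ := Submodule.mem_span_image_finset_iff_exists_fun L |>.1 hmem
  -- The value zero off the chosen set is a mere default: the sum runs over that set only.
  refine ⟨i₀, _, fun i => if h : i ∈ Finset.univ.image a then c ⟨i, h⟩ else 0, hi₀,
    hs.trans hcard.symm, ?_⟩
  rw [← hc, ← Finset.sum_coe_sort (Finset.univ.image a)]
  exact Finset.sum_congr rfl fun i _ => by simp only [dif_pos i.2]

namespace MultiOps

section Dimension

variable {K A I : Type*} [Field K] [AddCommGroup A] [Module K A] {n : I → ℕ}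

/-- The dimension of the closure of a point of the affine space of tuples. -/
noncomputable def pointDim {r : ℕ} (p : AffineTuples K A r) : ℕ :=
  Cardinal.toNat (Algebra.trdeg K (TupleRing K A r ⧸ p.asIdeal))

theorem trdeg_quotient_eq_pointDim {r : ℕ} (p : AffineTuples K A r) :
    Algebra.trdeg K (TupleRing K A r ⧸ p.asIdeal) = pointDim p := by
  obtain ⟨m, -, hm⟩ := exists_ringKrullDim_eq_trdeg_eq K (TupleRing K A r ⧸ p.asIdeal)
  rw [pointDim, hm, Cardinal.toNat_natCast]

theorem ringKrullDim_quotient_eq_pointDim {r : ℕ} (p : AffineTuples K A r) :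
    ringKrullDim (TupleRing K A r ⧸ p.asIdeal) = pointDim p := by
  obtain ⟨m, h, hm⟩ := exists_ringKrullDim_eq_trdeg_eq K (TupleRing K A r ⧸ p.asIdeal)
  rw [h, pointDim, hm, Cardinal.toNat_natCast]

theorem pointDim_le {r : ℕ} (p : AffineTuples K A r) :
    pointDim p ≤ r * Module.finrank K A := by
  have h := ringKrullDim_quotient_le p.asIdeal
  rw [ringKrullDim_quotient_eq_pointDim, MvPolynomial.ringKrullDim_of_isNoetherianRing] at h
  simp only [ringKrullDim_eq_zero_of_field, zero_add, Nat.card_eq_fintype_card,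
    Fintype.card_prod, Fintype.card_fin] at h
  exact_mod_cast h

theorem pointDim_eq_trdeg_residueField {r : ℕ} (p : AffineTuples K A r) :
    Algebra.trdeg K p.asIdeal.ResidueField = pointDim p := by
  have : Algebra.IsAlgebraic (TupleRing K A r ⧸ p.asIdeal) p.asIdeal.ResidueField :=
    IsLocalization.isAlgebraic _ (nonZeroDivisors (TupleRing K A r ⧸ p.asIdeal))
  rw [← trdeg_quotient_eq_pointDim,
    ← trdeg_add_eq K (TupleRing K A r ⧸ p.asIdeal) (A := p.asIdeal.ResidueField),
    trdeg_eq_zero (R := TupleRing K A r ⧸ p.asIdeal), add_zero]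

theorem trdeg_range_eq_pointDim {L : Type*} [Field L] [Algebra K L] {r : ℕ}
    (g : TupleRing K A r →ₐ[K] L) :
    Cardinal.toNat (Algebra.trdeg K g.range) = pointDim (kernelPoint g) := by
  have h := AlgEquiv.lift_trdeg_eq (Ideal.quotientKerEquivRange g)
  have h2 := congrArg Cardinal.toNat h
  rw [Cardinal.toNat_lift, Cardinal.toNat_lift] at h2
  exact h2.symm

variable [FiniteDimensional K A]

theorem topologicalKrullDim_nonGenerating (μ : MultiOps K A n) (r : ℕ) :
    topologicalKrullDim (μ.nonGenerating r) =
      ⨆ p ∈ μ.nonGenerating r, ((pointDim p : ℕ) : WithBot ℕ∞) := by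
  rw [nonGenerating_eq_zeroLocus, topologicalKrullDim_zeroLocus]
  simp only [ringKrullDim_quotient_eq_pointDim]

/-- The supremum is attained because `pointDim` is bounded by the dimension of the affine space. -/
theorem exists_topologicalKrullDim_nonGenerating_eq (μ : MultiOps K A n) (r : ℕ)
    (h : (μ.nonGenerating r).Nonempty) :
    ∃ p ∈ μ.nonGenerating r, topologicalKrullDim (μ.nonGenerating r) = (pointDim p : ℕ) ∧
      ∀ q ∈ μ.nonGenerating r, pointDim q ≤ pointDim p := by
  have hfin : (pointDim '' μ.nonGenerating r).Finite :=
    (Set.finite_Iic (r * Module.finrank K A)).subset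
      (Set.image_subset_iff.2 fun p _ => pointDim_le p)
  obtain ⟨_, ⟨p, hp, rfl⟩, hmax⟩ := hfin.exists_maximal (h.image _)
  have hle : ∀ q ∈ μ.nonGenerating r, pointDim q ≤ pointDim p := fun q hq =>
    (le_total (pointDim q) (pointDim p)).elim id (hmax ⟨q, hq, rfl⟩)
  refine ⟨p, hp, ?_, hle⟩
  rw [topologicalKrullDim_nonGenerating]
  refine le_antisymm (iSup₂_le fun q hq => ?_) (le_iSup₂_of_le p hp le_rfl)
  exact_mod_cast hle q hq

/-- The forgetful homomorphism of coordinate rings which corresponds to dropping the entry `j` of a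
tuple. -/
noncomputable def dropHom (K A : Type*) [Field K] [AddCommGroup A] [Module K A] {r : ℕ}
    (j : Fin (r + 1)) : TupleRing K A r →ₐ[K] TupleRing K A (r + 1) :=
  MvPolynomial.rename fun x => (j.succAbove x.1, x.2)

theorem tupleOf_comp_dropHom {L : Type*} [Field L] [Algebra K L] {r : ℕ} (j : Fin (r + 1))
    (g : TupleRing K A (r + 1) →ₐ[K] L) (i : Fin r) :
    tupleOf (g.comp (dropHom K A j)) i = tupleOf g (j.succAbove i) := by
  simp [tupleOf_eq_sum, dropHom]

/-- The field `L` is generated by the coordinates of the tuple. Without the redundant entry, these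
coordinates together with the coefficients of its linear relation still generate `L`. -/
theorem exists_trdeg_le_pointDim_add {L : Type*} [Field L] [Algebra K L] (μ : MultiOps K A n)
    {r : ℕ} (g : TupleRing K A (r + 1) →ₐ[K] L)
    (hg : ¬ (μ.baseChange L).Generates (Set.range (tupleOf g)))
    (hfrac : ∀ l, ∃ a b, g a / g b = l)
    (hr : Module.finrank L (Submodule.span L (Set.range (tupleOf g))) ≤ r) :
    ∃ q ∈ μ.nonGenerating r, Algebra.trdeg K L ≤
      (pointDim q + Module.finrank L (Submodule.span L (Set.range (tupleOf g))) : ℕ) := by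
  obtain ⟨j, s, c, hj, hs, hsum⟩ := exists_eq_sum_smul_ne (L := L) (tupleOf g)
    (by rw [Nat.card_eq_fintype_card, Fintype.card_fin]; omega)
  set g' := g.comp (dropHom K A j)
  refine ⟨kernelPoint g', ?_, ?_⟩
  · rw [kernelPoint_mem_nonGenerating_iff]
    refine fun h => hg (h.mono ?_)
    rintro _ ⟨i, rfl⟩
    exact ⟨j.succAbove i, (tupleOf_comp_dropHom j g i).symm⟩
  · let c' : s → L := fun i => c i
    let C := Algebra.adjoin g'.range (Set.range c')
    have hX : ∀ (i : Fin (r + 1)) (k), i ≠ j → g (MvPolynomial.X (i, k)) ∈ C := by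
      intro i k hi
      obtain ⟨i, rfl⟩ := Fin.exists_succAbove_eq hi
      have : g (MvPolynomial.X (j.succAbove i, k)) ∈ g'.range :=
        ⟨MvPolynomial.X (i, k), by simp [g', dropHom]⟩
      exact C.algebraMap_mem ⟨_, this⟩
    -- The linear relation, read in coordinates, expresses those of the dropped entry; `j ∉ s` keeps
    -- it from referring to itself.
    have hXj : ∀ k, g (MvPolynomial.X (j, k)) ∈ C := by
      intro k
      rw [(tupleOf_eq_iff g j _).1 hsum k]
      simp only [map_sum, map_smul, Finsupp.coe_finsetSum, Finset.sum_apply, Finsupp.smul_apply,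
        smul_eq_mul]
      refine C.sum_mem fun i hi => C.mul_mem (Algebra.subset_adjoin ⟨⟨i, hi⟩, rfl⟩) ?_
      rw [← (tupleOf_eq_iff g i _).1 rfl k]
      exact hX i k (ne_of_mem_of_not_mem hi hj)
    have hmem : ∀ a, g a ∈ C := by
      intro a
      induction a using MvPolynomial.induction_on with
      | C a =>
        rw [← MvPolynomial.algebraMap_eq, g.commutes]
        exact (C.restrictScalars K).algebraMap_mem a
      | add a b ha hb => rw [map_add]; exact C.add_mem ha hb
      | mul_X a x ha =>
        rw [map_mul]
        refine C.mul_mem ha ?_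
        obtain ⟨i, k⟩ := x
        by_cases hi : i = j
        · exact hi ▸ hXj k
        · exact hX i k hi
    have halg : Algebra.IsAlgebraic C L := by
      refine ⟨fun l => ?_⟩
      obtain ⟨a, b, rfl⟩ := hfrac l
      have h : ∀ a, IsAlgebraic C (g a) := fun a => isAlgebraic_algebraMap (⟨g a, hmem a⟩ : C)
      rw [div_eq_mul_inv]
      exact (h a).mul (h b).inv
    have h := trdeg_le_trdeg_add_card g'.range c'
    rw [Fintype.card_coe, hs] at h
    have : Algebra.FiniteType K g'.range :=
      Algebra.FiniteType.of_surjective g'.rangeRestrict g'.rangeRestrict_surjective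
    have hfin : Algebra.trdeg K g'.range < Cardinal.aleph0 := trdeg_lt_aleph0_of_finiteType
    -- Finiteness of the transcendence degree makes the conversion to a natural number lossless.
    rw [← trdeg_range_eq_pointDim g', Nat.cast_add, Cardinal.cast_toNat_of_lt_aleph0 hfin]
    exact h

theorem exists_pointDim_le_add (μ : MultiOps K A n) {r s : ℕ} (p : AffineTuples K A (r + 1))
    (hp : p ∈ μ.nonGenerating (r + 1)) (hr : s ≤ r)
    (hs : Module.finrank p.asIdeal.ResidueField
      (Submodule.span p.asIdeal.ResidueField (Set.range (tupleAt p))) ≤ s) :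
    ∃ q ∈ μ.nonGenerating r, pointDim p ≤ pointDim q + s := by
  rw [nonGenerating, Set.mem_ofPred_eq] at hp
  rw [tupleAt_eq_tupleOf] at hp hs
  obtain ⟨q, hq, hle⟩ := μ.exists_trdeg_le_pointDim_add _ hp (fun l => by
    obtain ⟨a, b, -, rfl⟩ := IsFractionRing.div_surjective
      (A := TupleRing K A (r + 1) ⧸ p.asIdeal) l
    obtain ⟨a, rfl⟩ := Ideal.Quotient.mk_surjective a
    obtain ⟨b, rfl⟩ := Ideal.Quotient.mk_surjective b
    exact ⟨a, b, rfl⟩) (hs.trans hr)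
  rw [pointDim_eq_trdeg_residueField, Nat.cast_le] at hle
  exact ⟨q, hq, hle.trans (by omega)⟩

end Dimension

end MultiOps

/-! ### The lower bound: generic tuples in a proper subalgebra. -/

/-- A subspace has a basis for which suitable coordinates form the dual basis. -/
theorem exists_basis_repr_eq_ite {F V ι : Type*} [Field F] [AddCommGroup V] [Module F V] [Finite ι]
    (e : Module.Basis ι F V) (B : Submodule F V) :
    ∃ (κ : Type) (_ : Fintype κ) (_ : DecidableEq κ) (a : κ → ι) (b : Module.Basis κ F B),
      ∀ k l, e.repr (b k) (a l) = if k = l then 1 else 0 := by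
  classical
  have := e.finiteDimensional_of_finite
  -- The coordinate functionals restricted to `B` span its dual, so some of them form a basis of the
  -- dual; the required basis of `B` is the one dual to it.
  let v : ι → Module.Dual F B := fun i => (e.coord i).comp B.subtype
  obtain ⟨κ', a', ha', hspan, hli⟩ := exists_linearIndependent' F v
  have := Finite.of_injective a' ha'
  have htop : ⊤ ≤ Submodule.span F (Set.range (v ∘ a')) := by
    rw [hspan]
    have h : Submodule.span F (Set.range e.coord) = ⊤ := by
      rw [← e.coe_dualBasis]
      exact e.dualBasis.span_eq
    have h2 : Set.range v = B.dualRestrict '' Set.range e.coord := by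
      rw [← Set.range_comp]
      rfl
    rw [h2, Submodule.span_image, h, Submodule.map_top,
      LinearMap.range_eq_top.2 Subspace.dualRestrict_surjective]
  let β' := Module.Basis.mk hli htop
  let ε := Finite.equivFin κ'
  let β := β'.reindex ε
  have hβ : ∀ l, β l = v (a' (ε.symm l)) := fun l => by simp [β, β']
  refine ⟨Fin (Nat.card κ'), inferInstance, inferInstance, fun l => a' (ε.symm l),
    β.dualBasis.map (Module.evalEquiv F B).symm, fun k l => ?_⟩
  have h : e.repr ((β.dualBasis.map (Module.evalEquiv F B).symm) k) (a' (ε.symm l)) =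
      β l ((Module.evalEquiv F B).symm (β.dualBasis k)) := by
    rw [hβ]
    rfl
  rw [h, Module.apply_evalEquiv_symm_apply, Module.Basis.dualBasis_apply_self]
  simp [eq_comm]

namespace MultiOps

universe u v w

section MaximalDimension

variable {K : Type u} {A : Type v} {I : Type w} [Field K] [AddCommGroup A] [Module K A]
  [FiniteDimensional K A] {n : I → ℕ}

/-- After some extension of the base field, there is a proper subalgebra of dimension `s`. -/
def HasProperSubalgebraOfDim (μ : MultiOps K A n) (s : ℕ) : Prop :=
  ∃ (L : Type u) (_ : Field L) (_ : Algebra K L) (S : Submodule L (L ⊗[K] A)),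
    (μ.baseChange L).IsSubalgebra S ∧ S ≠ ⊤ ∧ Module.finrank L S = s

theorem hasProperSubalgebraOfDim_of_isSubalgebra {μ : MultiOps K A n} {S : Submodule K A}
    (hS : μ.IsSubalgebra S) (hne : S ≠ ⊤) : ∃ s, μ.HasProperSubalgebraOfDim s := by
  let e := TensorProduct.lid K A
  refine ⟨_, K, _, _, S.comap e.toLinearMap, fun i x hx => ?_, fun h => hne ?_, rfl⟩
  · have hx' : x = fun j => (1 : K) ⊗ₜ[K] e (x j) := funext fun j => by
      rw [← TensorProduct.lid_symm_apply, LinearEquiv.symm_apply_apply]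
    rw [hx', baseChange_tmul K μ i (fun _ => 1)]
    simpa [e] using hS i _ hx
  · rw [← Submodule.map_comap_eq_of_surjective (f := e.toLinearMap) e.surjective S, h,
      Submodule.map_top]
    exact LinearMap.range_eq_top.2 e.surjective

theorem HasProperSubalgebraOfDim.le {μ : MultiOps K A n} {s : ℕ}
    (h : μ.HasProperSubalgebraOfDim s) : s ≤ Module.finrank K A := by
  obtain ⟨L, _, _, S, -, -, rfl⟩ := h
  rw [← Module.finrank_baseChange (R := L) (S := K)]
  exact S.finrank_le

/-- This is applied to residue fields of points of the affine space, which live in the universe of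
`K`. -/
theorem hasProperSubalgebraOfDim_adjoin {μ : MultiOps K A n} {L : Type u} [Field L] [Algebra K L]
    {s : Set (L ⊗[K] A)} (h : ¬ (μ.baseChange L).Generates s) :
    μ.HasProperSubalgebraOfDim (Module.finrank L ((μ.baseChange L).adjoin s)) :=
  ⟨L, _, _, _, isSubalgebra_adjoin _ _, h, rfl⟩

theorem HasProperSubalgebraOfDim.exists_le_pointDim {μ : MultiOps K A n} {s : ℕ}
    (h : μ.HasProperSubalgebraOfDim s) (r : ℕ) :
    ∃ p ∈ μ.nonGenerating r, r * s ≤ pointDim p := by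
  obtain ⟨F, _, _, B, hB, hne, rfl⟩ := h
  obtain ⟨κ, _, _, a, b, hab⟩ := exists_basis_repr_eq_ite (scalarBasis K A F) B
  -- The generic point of `B ^ r`: each entry is a combination of the basis `b` with independent
  -- variables as coefficients.
  let P := MvPolynomial (Fin r × κ) F
  let L := FractionRing P
  let f : F →ₐ[K] L := IsScalarTower.toAlgHom K F L
  let c : Fin r × κ → L := fun x => algebraMap P L (MvPolynomial.X x)
  let x : Fin r → L ⊗[K] A := fun j => ∑ k, c (j, k) • scalarMap A f (b k)
  let g : TupleRing K A r →ₐ[K] L :=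
    MvPolynomial.aeval fun y => (scalarBasis K A L).repr (x y.1) y.2
  have hg : ∀ j, tupleOf g j = x j := fun j =>
    (tupleOf_eq_iff g j _).2 fun k => MvPolynomial.aeval_X _ _
  refine ⟨kernelPoint g, ?_, ?_⟩
  · rw [kernelPoint_mem_nonGenerating_iff, funext hg]
    intro htop
    have hspan : (μ.baseChange L).adjoin (Set.range x) ≤
        Submodule.span L (Set.range fun k => scalarMap A f (b k)) := by
      have hBspan : Submodule.span L (scalarMap A f '' B) ≤
          Submodule.span L (Set.range fun k => scalarMap A f (b k)) := by
        refine Submodule.span_le.2 ?_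
        rintro _ ⟨y, hy, rfl⟩
        have hsum := congrArg (fun z : B => scalarMap A f z) (b.sum_repr ⟨y, hy⟩)
        simp only [Submodule.coe_sum, Submodule.coe_smul, map_sum, scalarMap_smul] at hsum
        rw [← hsum]
        exact Submodule.sum_mem _ fun k _ => Submodule.smul_mem _ _ (Submodule.subset_span ⟨k, rfl⟩)
      refine (adjoin_le _ (IsSubalgebra.span_scalarMap f hB) ?_).trans hBspan
      rintro _ ⟨j, rfl⟩
      exact Submodule.sum_mem _ fun k _ => Submodule.smul_mem _ _
        (Submodule.subset_span ⟨_, (b k).2, rfl⟩)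
    rw [htop, top_le_iff] at hspan
    have h1 := finrank_range_le_card (R := L) fun k => scalarMap A f (b k)
    rw [Set.finrank, hspan, finrank_top, Module.finrank_baseChange,
      ← Module.finrank_eq_card_basis b] at h1
    have h2 := Submodule.finrank_lt hne
    rw [Module.finrank_baseChange] at h2
    omega
  -- By the choice of `a` and `b`, the variables themselves occur among the coordinates of the
  -- tuple. They are independent over `F`, hence over `K`.
  · have hcoord : ∀ y : Fin r × κ, g (MvPolynomial.X (y.1, a y.2)) = c y := fun y => by
      simp [g, x, scalarBasis_repr_scalarMap, hab]
    have hinj : Function.Injective (algebraMap F P) := MvPolynomial.C_injective _ _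
    have hX : AlgebraicIndependent K (MvPolynomial.X : Fin r × κ → P) :=
      (MvPolynomial.algebraicIndependent_X (Fin r × κ) F).restrictScalars
        (algebraMap K F).injective
    have hc : AlgebraicIndependent K c :=
      hX.map' (f := IsScalarTower.toAlgHom K P L) (IsFractionRing.injective P L)
    let y : Fin r × κ → TupleRing K A r ⧸ RingHom.ker g := fun y =>
      Ideal.Quotient.mk _ (MvPolynomial.X (y.1, a y.2))
    have hy : AlgebraicIndependent K y := by
      refine AlgebraicIndependent.of_comp (Ideal.kerLiftAlg g) ?_
      convert hc using 1
      exact funext hcoord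
    have hle := hy.lift_cardinalMk_le_trdeg
    change _ ≤ Cardinal.lift (Algebra.trdeg K (TupleRing K A r ⧸ (kernelPoint g).asIdeal)) at hle
    rw [trdeg_quotient_eq_pointDim] at hle
    have h3 : Fintype.card (Fin r × κ) ≤ pointDim (kernelPoint g) := by
      rw [Cardinal.mk_fintype, Cardinal.lift_natCast, Cardinal.lift_natCast] at hle
      exact_mod_cast hle
    rwa [Fintype.card_prod, Fintype.card_fin, ← Module.finrank_eq_card_basis b] at h3

end MaximalDimension

end MultiOps

/-! ### Eventual linearity. -/

/-- A natural-valued sequence is eventually linear if it dominates a linear sequence and eventually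
grows by at most the slope of it in each step. -/
theorem exists_eventually_eq_mul_add {f : ℕ → ℕ} {a r₀ : ℕ} (h1 : ∀ r, r * a ≤ f r)
    (h2 : ∀ r, r₀ ≤ r → f (r + 1) ≤ f r + a) :
    ∃ b, ∀ᶠ r in Filter.atTop, f r = a * r + b := by
  -- By `h1` the truncated subtraction is a true one.
  let d : ℕ → ℕ := fun r => f (r₀ + r) - (r₀ + r) * a
  have hd : Antitone d := antitone_nat_of_succ_le fun r => by
    have h3 := h2 (r₀ + r) (by omega)
    have h4 : (r₀ + (r + 1)) * a = (r₀ + r) * a + a := by ring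
    simp only [d, h4]
    rw [show r₀ + (r + 1) = r₀ + r + 1 by ring]
    omega
  obtain ⟨m, hm⟩ := WellFounded.has_min (measure d).wf Set.univ ⟨0, trivial⟩
  refine ⟨d m, Filter.eventually_atTop.2 ⟨r₀ + m, fun r hr => ?_⟩⟩
  obtain ⟨r, rfl⟩ := Nat.exists_eq_add_of_le (show r₀ ≤ r by omega)
  have h3 : d r = d m := le_antisymm (hd (by omega)) (not_lt.1 (hm.2 r trivial))
  have h4 := h1 (r₀ + r)
  rw [← h3, mul_comm]
  simp only [d]
  omega

/-- The slope is the largest dimension of a proper subalgebra after an extension of the base field.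
The dimension of `Z_r` minus the linear term is eventually a nonincreasing sequence of natural
numbers, so that it is eventually constant whether or not the number of orbits is finite. -/
theorem mainTheorem6 {K A I : Type*} [Field K] [AddCommGroup A] [Module K A]
    [FiniteDimensional K A] {n : I → ℕ} (μ : MultiOps K A n)
    (hproper : ∃ S : Submodule K A, μ.IsSubalgebra S ∧ S ≠ ⊤)
    (horb : (μ.baseChange (AlgebraicClosure K)).FinitelyManyOrbits) :
    ∃ a b : ℕ, ∀ᶠ r : ℕ in Filter.atTop,
      topologicalKrullDim (μ.nonGenerating r) = ((a * r + b : ℕ) : WithBot ℕ∞) := by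
  obtain ⟨S, hS, hne⟩ := hproper
  have hfin : {s | μ.HasProperSubalgebraOfDim s}.Finite :=
    (Set.finite_Iic (Module.finrank K A)).subset fun s hs => hs.le
  obtain ⟨a, ha, hmax⟩ :=
    hfin.exists_maximal (MultiOps.hasProperSubalgebraOfDim_of_isSubalgebra hS hne)
  have hle : ∀ s, μ.HasProperSubalgebraOfDim s → s ≤ a := fun s hs =>
    (le_total s a).elim id (hmax hs)
  have hnonempty : ∀ r, (μ.nonGenerating r).Nonempty := fun r =>
    let ⟨p, hp, _⟩ := ha.exists_le_pointDim r
    ⟨p, hp⟩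
  choose p hp hdim hpmax using fun r =>
    μ.exists_topologicalKrullDim_nonGenerating_eq r (hnonempty r)
  -- The threshold equals the slope: with `r ≥ a`, the `r + 1` entries outnumber the dimension of
  -- their span.
  obtain ⟨b, hb⟩ := exists_eventually_eq_mul_add (f := fun r => MultiOps.pointDim (p r))
    (a := a) (r₀ := a) (fun r => by
      obtain ⟨q, hq, hqr⟩ := ha.exists_le_pointDim r
      exact hqr.trans (hpmax r q hq)) (fun r hr => by
      obtain ⟨q, hq, hqr⟩ := μ.exists_pointDim_le_add (p (r + 1)) (hp (r + 1)) hr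
        -- The span lies in the generated subalgebra, which is proper over the residue field and so
        -- has dimension at most `a`.
        ((Submodule.finrank_mono (Submodule.span_le.2 (MultiOps.subset_adjoin _ _))).trans
          (hle _ (MultiOps.hasProperSubalgebraOfDim_adjoin (hp (r + 1)))))
      exact hqr.trans (Nat.add_le_add_right (hpmax r q hq) a))
  exact ⟨a, b, hb.mono fun r hr => by rw [hdim, hr]⟩
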